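/- Let $d\in\mathbb N$. A state is a positive semidefinite complex $d\times d$ matrix of trace $1$. A reverse test of a pair of states $\{\rho,\sigma\}$ is a triple $(\Phi,\{p,q\})$ consisting of probability distributions $p,q$ on a finite set $\mathcal X$ (of arbitrary cardinality), viewed as diagonal density matrices, and a completely positive trace preserving map $\Phi$ with $\Phi(p)=\rho$ and $\Phi(q)=\sigma$. Put $$F(p,q)=\sum_{x}\sqrt{p(x)}\sqrt{q(x)},\qquad \Delta(p,q)=\tfrac12\sum_x|p(x)-q(x)|,$$ $$F_{\min}(\rho,\sigma)=\max F(p,q),\qquad \Delta_{\max}(\rho,\sigma)=\min \Delta(p,q),$$ where the maximum and the minimum are over all reverse tests $(\Phi,\{p,q\})$ of $\{\rho,\sigma\}$. Put $$\mathrm D^R(\rho\|\sigma)=\operatorname{tr}\rho\ln\bigl(\sqrt\rho\,\sigma^{-1}\sqrt\rho\bigr)$$ if $\operatorname{supp}\rho\subseteq\operatorname{supp}\sigma$ (in particular if $\sigma$ is invertible; in general $\sigma^{-1}$ is the Moore–Penrose inverse, and the logarithm is taken on the support of $\rho$, i.e. $0\ln 0=0$), and $\mathrm D^R(\rho\|\sigma)=+\infty$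 otherwise. Theorem. The maximum and the minimum above are attained for all states $\rho,\sigma$, and for all states $\rho,\sigma,\rho_0,\rho_1,\sigma_0,\sigma_1$ and all $\lambda\in[0,1]$, $$\Delta_{\max}\bigl(\lambda\rho_0+(1-\lambda)\rho_1,\ \lambda\sigma_0+(1-\lambda)\sigma_1\bigr)\le\lambda\,\Delta_{\max}(\rho_0,\sigma_0)+(1-\lambda)\,\Delta_{\max}(\rho_1,\sigma_1),$$ $$1-F_{\min}(\rho,\sigma)\le\Delta_{\max}(\rho,\sigma)\le\sqrt{1-F_{\min}(\rho,\sigma)^2},$$ $$\mathrm D^R(\rho\|\sigma)\ge\tfrac12\,\Delta_{\max}(\rho,\sigma)^2 .$$ -/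

import Mathlib

namespace ReverseTest

open scoped Matrix ComplexOrder

/-- A quantum state on `ℂ^d`: a positive semidefinite matrix of trace one. -/
def IsState {d : ℕ} (ρ : Matrix (Fin d) (Fin d) ℂ) : Prop :=
  ρ.PosSemidef ∧ ρ.trace = 1

/-- Complete positivity: for every `k`, applying `Φ` to every block of a positive semidefinite
`k × k` block matrix gives a positive semidefinite block matrix (`Matrix.comp` flattens block
matrices). -/
def IsCompletelyPositive {m d : ℕ}
    (Φ : Matrix (Fin m) (Fin m) ℂ →ₗ[ℂ] Matrix (Fin d) (Fin d) ℂ) : Prop :=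
  ∀ (k : ℕ) (A : Matrix (Fin k) (Fin k) (Matrix (Fin m) (Fin m) ℂ)),
    (Matrix.comp (Fin k) (Fin k) (Fin m) (Fin m) ℂ A).PosSemidef →
      (Matrix.comp (Fin k) (Fin k) (Fin d) (Fin d) ℂ (A.map Φ)).PosSemidef

/-- Completely positive and trace preserving maps. -/
def IsCPTP {m d : ℕ}
    (Φ : Matrix (Fin m) (Fin m) ℂ →ₗ[ℂ] Matrix (Fin d) (Fin d) ℂ) : Prop :=
  IsCompletelyPositive Φ ∧ ∀ A, (Φ A).trace = A.trace

/-- A distribution on an `m`-point set, viewed as a diagonal density matrix. -/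
def diagState {m : ℕ} (p : Fin m → ℝ) : Matrix (Fin m) (Fin m) ℂ :=
  Matrix.diagonal fun x => (p x : ℂ)

/-- `(Φ, {p, q})` is a reverse test of `{ρ, σ}`: `p` and `q` are probability distributions on an
`m`-point set and `Φ` is a CPTP map with `Φ(p) = ρ` and `Φ(q) = σ`. -/
structure IsReverseTest {m d : ℕ}
    (Φ : Matrix (Fin m) (Fin m) ℂ →ₗ[ℂ] Matrix (Fin d) (Fin d) ℂ) (p q : Fin m → ℝ)
    (ρ σ : Matrix (Fin d) (Fin d) ℂ) : Prop where
  left_mem : p ∈ stdSimplex ℝ (Fin m)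
  right_mem : q ∈ stdSimplex ℝ (Fin m)
  cptp : IsCPTP Φ
  map_left : Φ (diagState p) = ρ
  map_right : Φ (diagState q) = σ

/-- Classical fidelity. -/
noncomputable def classicalFidelity {m : ℕ} (p q : Fin m → ℝ) : ℝ :=
  ∑ x, √(p x) * √(q x)

/-- Classical statistical distance (total variation). -/
noncomputable def classicalDelta {m : ℕ} (p q : Fin m → ℝ) : ℝ :=
  (1 / 2) * ∑ x, |p x - q x|

/-- The values of the classical fidelity on the reverse tests of `{ρ, σ}`, over all finite
outcome sets. -/
def fidelityValues {d : ℕ} (ρ σ : Matrix (Fin d) (Fin d) ℂ) : Set ℝ :=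
  {t | ∃ (m : ℕ) (Φ : Matrix (Fin m) (Fin m) ℂ →ₗ[ℂ] Matrix (Fin d) (Fin d) ℂ)
    (p q : Fin m → ℝ), IsReverseTest Φ p q ρ σ ∧ t = classicalFidelity p q}

/-- The values of the classical statistical distance on the reverse tests of `{ρ, σ}`, over all
finite outcome sets. -/
def deltaValues {d : ℕ} (ρ σ : Matrix (Fin d) (Fin d) ℂ) : Set ℝ :=
  {t | ∃ (m : ℕ) (Φ : Matrix (Fin m) (Fin m) ℂ →ₗ[ℂ] Matrix (Fin d) (Fin d) ℂ)
    (p q : Fin m → ℝ), IsReverseTest Φ p q ρ σ ∧ t = classicalDelta p q}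

/-- `F_min`: the largest classical fidelity over the reverse tests. -/
noncomputable def FMin {d : ℕ} (ρ σ : Matrix (Fin d) (Fin d) ℂ) : ℝ :=
  sSup (fidelityValues ρ σ)

/-- `Δ_max`: the smallest classical statistical distance over the reverse tests. -/
noncomputable def DeltaMax {d : ℕ} (ρ σ : Matrix (Fin d) (Fin d) ℂ) : ℝ :=
  sInf (deltaValues ρ σ)

/-- The (Moore-Penrose) inverse of a Hermitian matrix, by functional calculus with `0⁻¹ = 0`;
it is the ordinary inverse when the matrix is invertible. -/
noncomputable def genInv {d : ℕ} (σ : Matrix (Fin d) (Fin d) ℂ) : Matrix (Fin d) (Fin d) ℂ :=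
  cfc (fun t : ℝ => t⁻¹) σ

open scoped Classical in
/-- `D^R(ρ‖σ) = tr ρ ln (√ρ σ⁻¹ √ρ)` if the support of `ρ` is contained in that of `σ`
(in particular if `σ` is invertible), and `+∞` otherwise. The functional calculus uses
`Real.log 0 = 0`, which here is the convention `0 ln 0 = 0`: the kernel of `√ρ σ⁻¹ √ρ` is the
kernel of `ρ`. The trace is real. -/
noncomputable def DR {d : ℕ} (ρ σ : Matrix (Fin d) (Fin d) ℂ) : EReal :=
  if ∀ v : Fin d → ℂ, σ *ᵥ v = 0 → ρ *ᵥ v = 0 then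
    (((ρ * cfc Real.log (cfc Real.sqrt ρ * genInv σ * cfc Real.sqrt ρ)).trace.re : ℝ) : EReal)
  else ⊤

end ReverseTest

/-! A map Φ acts on diagonal matrices only through the states ω_x = Φ(|x⟩⟨x|), so a reverse test
amounts to a simultaneous decomposition ρ = ∑ p_x ω_x, σ = ∑ q_x ω_x. Both F and Δ sum a continuous,
positively homogeneous function of (p_x, q_x), so every outcome can be rescaled to p_x + q_x = 2.
The attainable triples (ρ, σ, value) then fill the part over pairs of states of the convex hull of a
compact set (`mem_testValues_iff`). By Carathéodory the hull is compact, which gives attainment; its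
convexity gives joint convexity of Δ_max.

The comparison with F_min applies the classical inequalities 1 - F ≤ Δ and Δ² ≤ 1 - F² to a test
optimal for Δ, respectively for F.

For the last bound, let T = √ρ σ⁻¹ √ρ have eigenvalues r_x and eigenprojections P_x. The matrices
W_x = √ρ P_x √ρ sum to ρ, while ∑ r_x⁻¹ W_x ≤ σ; an extra outcome with p = 0 carries the difference.
This test has F = ∑ tr(W_x) r_x^(-1/2), and ln s ≤ s - 1 at s = r_x^(-1/2) yields 2(1 - F) ≤ D^R
(`exists_fidelity_of_support`). Since Δ_max² ≤ 1 - F_min² ≤ 2(1 - F_min), the bound holds even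
without the factor 1/2. -/

namespace ReverseTest

open scoped Matrix ComplexOrder

variable {d : ℕ}

/-! ### Compactness of convex hulls and of the state space -/

/-- In a finite-dimensional space the convex hull of a compact set is compact. -/
theorem isCompact_convexHull_of_isCompact {E : Type*} [AddCommGroup E] [Module ℝ E]
    [TopologicalSpace E] [ContinuousAdd E] [ContinuousSMul ℝ E] [FiniteDimensional ℝ E]
    {s : Set E} (hs : IsCompact s) : IsCompact (convexHull ℝ s) := by
  classical
  rcases s.eq_empty_or_nonempty with rfl | ⟨z₀, hz₀⟩
  · simp
  let n := Module.finrank ℝ E + 1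
  let f : (Fin n → ℝ) × (Fin n → E) → E := fun u => ∑ i, u.1 i • u.2 i
  have hf : Continuous f := by fun_prop
  have hK : IsCompact (stdSimplex ℝ (Fin n) ×ˢ Set.univ.pi fun _ : Fin n => s) :=
    (isCompact_stdSimplex ℝ (Fin n)).prod (isCompact_univ_pi fun _ => hs)
  suffices h : convexHull ℝ s = f '' (stdSimplex ℝ (Fin n) ×ˢ Set.univ.pi fun _ : Fin n => s) by
    rw [h]; exact hK.image hf
  apply Set.Subset.antisymm
  · intro x hx
    -- Carathéodory: affinely independent points number at most `finrank + 1`. Unused slots are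
    -- filled below with weight 0 at `z₀`.
    obtain ⟨ι, _, z, w, hz, hind, hw, hsum, rfl⟩ := eq_pos_convex_span_of_mem_convexHull hx
    have hcard : Fintype.card ι ≤ Fintype.card (Fin n) := by
      rw [Fintype.card_fin]
      exact hind.card_le_finrank_succ.trans
        (Nat.add_le_add_right (Submodule.finrank_le _) 1)
    obtain ⟨e⟩ := Function.Embedding.nonempty_of_card_le hcard
    refine ⟨(Function.extend e w 0, Function.extend e z fun _ => z₀), ⟨⟨fun j => ?_, ?_⟩, ?_⟩, ?_⟩
    · by_cases h : ∃ i, e i = j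
      · obtain ⟨i, rfl⟩ := h
        simpa [e.injective.extend_apply] using (hw i).le
      · simp [Function.extend_apply' _ _ _ h]
    · rw [← hsum, Fintype.sum_of_injective e e.injective w]
      · intro j hj
        simp [Function.extend_apply' _ _ _ hj]
      · intro i
        simp [e.injective.extend_apply]
    · intro j _
      by_cases h : ∃ i, e i = j
      · obtain ⟨i, rfl⟩ := h
        simpa [e.injective.extend_apply] using hz ⟨i, rfl⟩
      · simpa [Function.extend_apply' _ _ _ h] using hz₀
    · simp only [f]
      rw [Fintype.sum_of_injective e e.injective (fun i => w i • z i)]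
      · intro j hj
        simp [Function.extend_apply' _ _ _ hj]
      · intro i
        simp [e.injective.extend_apply]
  · rintro _ ⟨⟨w, z⟩, ⟨⟨hw, hsum⟩, hz⟩, rfl⟩
    exact mem_convexHull_of_exists_fintype w z hw hsum (fun i => hz i trivial) rfl

/-- The set of states is compact. -/
theorem isCompact_setOf_isState (d : ℕ) :
    IsCompact {ω : Matrix (Fin d) (Fin d) ℂ | IsState ω} := by
  let S : Set (Matrix (Fin d) (Fin d) ℂ) := {B | (Bᴴ * B).trace = 1}
  have hS : IsCompact S := by
    have hbox : IsCompact (Set.univ.pi fun _ : Fin d => Set.univ.pi fun _ : Fin d =>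
        Metric.closedBall (0 : ℂ) 1) :=
      isCompact_univ_pi fun _ => isCompact_univ_pi fun _ => isCompact_closedBall _ _
    refine hbox.of_isClosed_subset ?_ ?_
    · exact isClosed_eq (by fun_prop) continuous_const
    · intro (B : Matrix (Fin d) (Fin d) ℂ) hB i _ j _
      have h : ∑ j, ∑ i, ‖B i j‖ ^ 2 = 1 := by
        have := congrArg Complex.re (show (Bᴴ * B).trace = 1 from hB)
        simpa [Matrix.trace, Matrix.mul_apply, ← Complex.normSq_eq_conj_mul_self,
          Complex.normSq_eq_norm_sq, ← Complex.ofReal_pow] using this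
      have h1 : ‖B i j‖ ^ 2 ≤ 1 := by
        rw [← h]
        refine le_trans ?_ (Finset.single_le_sum
          (f := fun j => ∑ i, ‖B i j‖ ^ 2) (fun _ _ => by positivity) (Finset.mem_univ j))
        exact Finset.single_le_sum (f := fun i => ‖B i j‖ ^ 2) (fun _ _ => by positivity)
          (Finset.mem_univ i)
      have h2 : ‖B i j‖ ≤ 1 := (sq_le_one_iff₀ (norm_nonneg _)).1 h1
      simpa using h2
  -- The states are the image of the Hilbert–Schmidt unit sphere under B ↦ Bᴴ B.
  have himg : {ω : Matrix (Fin d) (Fin d) ℂ | IsState ω} = (fun B => Bᴴ * B) '' S := by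
    ext ω
    constructor
    · rintro ⟨hpos, htr⟩
      open scoped MatrixOrder in
      obtain ⟨B, rfl⟩ := CStarAlgebra.nonneg_iff_eq_star_mul_self.mp hpos.nonneg
      exact ⟨B, htr, rfl⟩
    · rintro ⟨B, hB, rfl⟩
      exact ⟨Matrix.posSemidef_conjTranspose_mul_self B, hB⟩
  rw [himg]
  exact hS.image (by fun_prop)

/-! ### Reverse tests as simultaneous decompositions -/

/-- The map that measures in the standard basis and prepares `ω x` on outcome `x`. -/
noncomputable def prepare {m : ℕ} (ω : Fin m → Matrix (Fin d) (Fin d) ℂ) :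
    Matrix (Fin m) (Fin m) ℂ →ₗ[ℂ] Matrix (Fin d) (Fin d) ℂ where
  toFun A := ∑ x, A x x • ω x
  map_add' A B := by simp [add_smul, Finset.sum_add_distrib]
  map_smul' c A := by simp [mul_smul, Finset.smul_sum]

theorem prepare_apply {m : ℕ} (ω : Fin m → Matrix (Fin d) (Fin d) ℂ)
    (A : Matrix (Fin m) (Fin m) ℂ) : prepare ω A = ∑ x, A x x • ω x := rfl

-- The blockwise image is a sum of Kronecker products of principal submatrices of the input with the
-- states `ω x`, and each such product is positive.
open scoped Kronecker in
theorem isCPTP_prepare {m : ℕ} {ω : Fin m → Matrix (Fin d) (Fin d) ℂ} (hω : ∀ x, IsState (ω x)) :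
    IsCPTP (prepare ω) := by
  refine ⟨fun k A hA => ?_, fun A => ?_⟩
  · have h : Matrix.comp (Fin k) (Fin k) (Fin d) (Fin d) ℂ (A.map (prepare ω)) =
        ∑ x, (Matrix.comp (Fin k) (Fin k) (Fin m) (Fin m) ℂ A).submatrix
          (fun i => (i, x)) (fun i => (i, x)) ⊗ₖ ω x := by
      ext ⟨i, a⟩ ⟨j, b⟩
      change prepare ω (A i j) a b = _
      simp only [prepare_apply, Matrix.sum_apply]
      rfl
    rw [h]
    exact Matrix.posSemidef_sum _ fun x _ => (hA.submatrix _).kronecker (hω x).1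
  · simp only [prepare_apply, Matrix.trace_sum, Matrix.trace_smul, (hω _).2, smul_eq_mul, mul_one]
    rfl

theorem posSemidef_single (x : Fin d) : (Matrix.single x x (1 : ℂ)).PosSemidef := by
  rw [← Matrix.diagonal_single]
  exact Matrix.PosSemidef.diagonal (Pi.single_nonneg.2 zero_le_one)

theorem map_diagState {m : ℕ} (Φ : Matrix (Fin m) (Fin m) ℂ →ₗ[ℂ] Matrix (Fin d) (Fin d) ℂ)
    (p : Fin m → ℝ) : Φ (diagState p) = ∑ x, p x • Φ (Matrix.single x x 1) := by
  have h : diagState p = ∑ x, (p x : ℂ) • Matrix.single x x (1 : ℂ) := by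
    ext i j
    rcases eq_or_ne i j with rfl | hij
    · simp [diagState, Matrix.sum_apply, Matrix.single_apply]
    · rw [diagState, Matrix.diagonal_apply_ne _ hij, Matrix.sum_apply]
      refine (Finset.sum_eq_zero fun x _ => ?_).symm
      have hx : ¬(x = i ∧ x = j) := fun hx => hij (hx.1.symm.trans hx.2)
      simp [hx]
  rw [h, map_sum]
  exact Finset.sum_congr rfl fun x _ => by rw [map_smul, Complex.coe_smul]

/-- The image of a basis state under a completely positive trace preserving map is a state. -/
theorem IsCPTP.isState_single {m : ℕ}
    {Φ : Matrix (Fin m) (Fin m) ℂ →ₗ[ℂ] Matrix (Fin d) (Fin d) ℂ} (hΦ : IsCPTP Φ) (x : Fin m) :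
    IsState (Φ (Matrix.single x x 1)) := by
  refine ⟨?_, by rw [hΦ.2]; simp⟩
  have h := hΦ.1 1 (fun _ _ => Matrix.single x x 1) ((posSemidef_single x).submatrix Prod.snd)
  exact h.submatrix fun a => ((0 : Fin 1), a)

theorem IsState.trace_re {ρ : Matrix (Fin d) (Fin d) ℂ} (hρ : IsState ρ) : ρ.trace.re = 1 := by
  simp [hρ.2]

/-- A pair of nonnegative combinations of the same positive semidefinite matrices yields a reverse
test, and every positively homogeneous function takes the expected value on it. -/
theorem exists_isReverseTest {ι : Type*} [Fintype ι] {ρ σ : Matrix (Fin d) (Fin d) ℂ}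
    (hρ : IsState ρ) (hσ : IsState σ) (W : ι → Matrix (Fin d) (Fin d) ℂ)
    (hW : ∀ i, (W i).PosSemidef) (a b : ι → ℝ) (ha : ∀ i, 0 ≤ a i) (hb : ∀ i, 0 ≤ b i)
    (hWρ : ∑ i, a i • W i = ρ) (hWσ : ∑ i, b i • W i = σ) :
    ∃ (m : ℕ) (Φ : Matrix (Fin m) (Fin m) ℂ →ₗ[ℂ] Matrix (Fin d) (Fin d) ℂ) (p q : Fin m → ℝ),
      IsReverseTest Φ p q ρ σ ∧ ∀ f : ℝ → ℝ → ℝ,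
        (∀ c u v : ℝ, 0 ≤ c → f (c * u) (c * v) = c * f u v) →
          ∑ x, f (p x) (q x) = ∑ i, (W i).trace.re * f (a i) (b i) := by
  classical
  let e := (Fintype.equivFin ι).symm
  have htr : ∀ i, 0 ≤ (W i).trace.re := fun i => (Complex.nonneg_iff.1 (hW i).trace_nonneg).1
  have htr' : ∀ i, ((W i).trace.re : ℂ) = (W i).trace := fun i =>
    Complex.ext rfl (Complex.nonneg_iff.1 (hW i).trace_nonneg).2
  -- Trace zero forces `W i = 0`; that outcome has weight 0, so any state serves and `ρ` is at hand.
  let ω : ι → Matrix (Fin d) (Fin d) ℂ := fun i =>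
    if (W i).trace.re = 0 then ρ else (W i).trace.re⁻¹ • W i
  have hω : ∀ i, IsState (ω i) := by
    intro i
    by_cases h : (W i).trace.re = 0
    · simpa [ω, h] using hρ
    · simp only [ω, h, if_false]
      refine ⟨(hW i).smul (inv_nonneg.2 (htr i)), ?_⟩
      rw [Matrix.trace_smul, Complex.real_smul]
      nth_rewrite 2 [← htr' i]
      rw [← Complex.ofReal_mul, inv_mul_cancel₀ h, Complex.ofReal_one]
  have hωW : ∀ i, (W i).trace.re • ω i = W i := by
    intro i
    by_cases h : (W i).trace.re = 0
    · have h0 : W i = 0 := (hW i).trace_eq_zero_iff.1 (by rw [← htr' i, h, Complex.ofReal_zero])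
      simp [h0]
    · simp [ω, h, smul_smul]
  have hsum : ∀ (c : ι → ℝ) (τ : Matrix (Fin d) (Fin d) ℂ), ∑ i, c i • W i = τ → IsState τ →
      ∑ i, (W i).trace.re * c i = 1 := by
    intro c τ h hτ
    have := hτ.trace_re
    rw [← h, Matrix.trace_sum, Complex.re_sum] at this
    simpa [mul_comm] using this
  have hmap : ∀ (c : ι → ℝ) (τ : Matrix (Fin d) (Fin d) ℂ), ∑ i, c i • W i = τ →
      prepare (fun x => ω (e x)) (diagState fun x => (W (e x)).trace.re * c (e x)) = τ := by
    intro c τ h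
    rw [prepare_apply, ← h, ← e.sum_comp]
    refine Finset.sum_congr rfl fun x _ => ?_
    conv_rhs => rw [← hωW (e x), smul_smul, mul_comm]
    simp [diagState, ← Complex.coe_smul]
  refine ⟨Fintype.card ι, prepare fun x => ω (e x), fun x => (W (e x)).trace.re * a (e x),
    fun x => (W (e x)).trace.re * b (e x), ⟨⟨fun x => mul_nonneg (htr _) (ha _), ?_⟩,
    ⟨fun x => mul_nonneg (htr _) (hb _), ?_⟩, isCPTP_prepare fun x => hω _, hmap a ρ hWρ,
    hmap b σ hWσ⟩, fun f hf => ?_⟩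
  · rw [e.sum_comp fun i => (W i).trace.re * a i]; exact hsum a ρ hWρ hρ
  · rw [e.sum_comp fun i => (W i).trace.re * b i]; exact hsum b σ hWσ hσ
  · rw [← e.sum_comp]
    exact Finset.sum_congr rfl fun x _ => hf _ _ _ (htr _)

/-! ### Test values as slices of a compact convex set -/

/-- The values of `∑ x, f (p x) (q x)` on the reverse tests of `{ρ, σ}`. -/
def testValues (f : ℝ → ℝ → ℝ) (ρ σ : Matrix (Fin d) (Fin d) ℂ) : Set ℝ :=
  {t | ∃ (m : ℕ) (Φ : Matrix (Fin m) (Fin m) ℂ →ₗ[ℂ] Matrix (Fin d) (Fin d) ℂ)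
    (p q : Fin m → ℝ), IsReverseTest Φ p q ρ σ ∧ t = ∑ x, f (p x) (q x)}

/-- The contributions of a single outcome of total weight two to `ρ`, `σ` and `f`. -/
def outcomes (d : ℕ) (f : ℝ → ℝ → ℝ) :
    Set (Matrix (Fin d) (Fin d) ℂ × Matrix (Fin d) (Fin d) ℂ × ℝ) :=
  (fun u : ℝ × Matrix (Fin d) (Fin d) ℂ => (u.1 • u.2, (2 - u.1) • u.2, f u.1 (2 - u.1))) ''
    (Set.Icc 0 2 ×ˢ {ω | IsState ω})

theorem isCompact_convexHull_outcomes (d : ℕ) {f : ℝ → ℝ → ℝ}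
    (hf : Continuous (Function.uncurry f)) :
    IsCompact (convexHull ℝ (outcomes d f)) := by
  refine isCompact_convexHull_of_isCompact ?_
  refine (isCompact_Icc.prod (isCompact_setOf_isState d)).image ?_
  have : Continuous fun u : ℝ × Matrix (Fin d) (Fin d) ℂ => f u.1 (2 - u.1) :=
    hf.comp (g := Function.uncurry f) (f := fun u : ℝ × Matrix (Fin d) (Fin d) ℂ => (u.1, 2 - u.1))
      (by fun_prop)
  fun_prop

/-- Homogeneity lets outcome x be written as the weight (p x + q x)/2 times a point of `outcomes`;
these weights sum to 1, so they are convex coefficients. Conversely, a convex combination of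
outcomes is a simultaneous decomposition of ρ and σ. -/
theorem mem_testValues_iff {f : ℝ → ℝ → ℝ}
    (hf : ∀ c u v : ℝ, 0 ≤ c → f (c * u) (c * v) = c * f u v)
    {ρ σ : Matrix (Fin d) (Fin d) ℂ} (hρ : IsState ρ) (hσ : IsState σ) {t : ℝ} :
    t ∈ testValues f ρ σ ↔ (ρ, σ, t) ∈ convexHull ℝ (outcomes d f) := by
  constructor
  · rintro ⟨m, Φ, p, q, h, rfl⟩
    have hp := h.left_mem
    have hq := h.right_mem
    let w : Fin m → ℝ := fun x => (p x + q x) / 2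
    have hw : ∀ x, 0 ≤ w x := fun x => by have := hp.1 x; have := hq.1 x; simp only [w]; linarith
    -- If `w x = 0`, then p x = q x = 0, so the default value of the quotient is harmless.
    let r : Fin m → ℝ := fun x => p x / w x
    have hwp : ∀ x, w x * r x = p x := by
      intro x
      by_cases h0 : w x = 0
      · have := hp.1 x; have := hq.1 x
        have : p x = 0 := by simp only [w] at h0; linarith
        simp [h0, this]
      · exact mul_div_cancel₀ _ h0
    have hwq : ∀ x, w x * (2 - r x) = q x := by
      intro x
      rw [mul_sub, hwp]
      simp only [w]; ring
    have hr : ∀ x, r x ∈ Set.Icc (0 : ℝ) 2 := by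
      intro x
      refine ⟨div_nonneg (hp.1 x) (hw x), div_le_of_le_mul₀ (hw x) zero_le_two ?_⟩
      have := hq.1 x
      simp only [w]; linarith
    refine mem_convexHull_of_exists_fintype w
      (fun x => (r x • Φ (Matrix.single x x 1), (2 - r x) • Φ (Matrix.single x x 1),
        f (r x) (2 - r x))) hw ?_ (fun x => ⟨(r x, _), ⟨hr x, h.cptp.isState_single x⟩, rfl⟩) ?_
    · have h1 := hp.2; have h2 := hq.2
      simp only [w]
      rw [← Finset.sum_div, Finset.sum_add_distrib, h1, h2]; norm_num
    · simp only [Prod.smul_mk, smul_smul, hwp, hwq, smul_eq_mul, ← hf _ _ _ (hw _)]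
      refine Prod.ext ?_ (Prod.ext ?_ ?_)
      · simp [Prod.fst_sum, ← map_diagState, h.map_left]
      · simp [Prod.fst_sum, Prod.snd_sum, ← map_diagState, h.map_right]
      · simp [Prod.snd_sum]
  · intro h
    obtain ⟨ι, _, w, z, hw, hsum, hz, hx⟩ := mem_convexHull_iff_exists_fintype.1 h
    choose u hu huz using hz
    have h1 := congrArg Prod.fst hx
    have h2 := congrArg (fun y => y.2.1) hx
    have h3 := congrArg (fun y => y.2.2) hx
    simp only [← huz, Prod.fst_sum, Prod.snd_sum, Prod.smul_fst, Prod.smul_snd, smul_smul,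
      smul_eq_mul] at h1 h2 h3
    obtain ⟨m, Φ, p, q, ht, hval⟩ := exists_isReverseTest hρ hσ (fun i => (u i).2)
      (fun i => (hu i).2.1) (fun i => w i * (u i).1) (fun i => w i * (2 - (u i).1))
      (fun i => mul_nonneg (hw i) (hu i).1.1)
      (fun i => mul_nonneg (hw i) (sub_nonneg.2 (hu i).1.2)) h1 h2
    refine ⟨m, Φ, p, q, ht, ?_⟩
    rw [hval f hf, ← h3]
    refine Finset.sum_congr rfl fun i _ => ?_
    rw [(hu i).2.trace_re, one_mul, hf _ _ _ (hw i)]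

theorem testValues_nonempty (f : ℝ → ℝ → ℝ) {ρ σ : Matrix (Fin d) (Fin d) ℂ} (hρ : IsState ρ)
    (hσ : IsState σ) : (testValues f ρ σ).Nonempty := by
  obtain ⟨m, Φ, p, q, h, -⟩ := exists_isReverseTest hρ hσ ![ρ, σ]
    (by intro i; fin_cases i; exacts [hρ.1, hσ.1]) ![1, 0] ![0, 1]
    (by intro i; fin_cases i <;> simp) (by intro i; fin_cases i <;> simp) (by simp) (by simp)
  exact ⟨_, m, Φ, p, q, h, rfl⟩

theorem isCompact_testValues {f : ℝ → ℝ → ℝ} (hfc : Continuous (Function.uncurry f))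
    (hf : ∀ c u v : ℝ, 0 ≤ c → f (c * u) (c * v) = c * f u v)
    {ρ σ : Matrix (Fin d) (Fin d) ℂ} (hρ : IsState ρ) (hσ : IsState σ) :
    IsCompact (testValues f ρ σ) := by
  have hK := isCompact_convexHull_outcomes d hfc
  have hcl : IsClosed {y : Matrix (Fin d) (Fin d) ℂ × Matrix (Fin d) (Fin d) ℂ × ℝ |
      y.1 = ρ ∧ y.2.1 = σ} :=
    (isClosed_eq (by fun_prop) continuous_const).inter (isClosed_eq (by fun_prop) continuous_const)
  have himg := (hK.inter_right hcl).image (f := fun y => y.2.2) (by fun_prop)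
  convert himg using 1
  ext t
  rw [mem_testValues_iff hf hρ hσ]
  constructor
  · exact fun h => ⟨(ρ, σ, t), ⟨h, rfl, rfl⟩, rfl⟩
  · rintro ⟨⟨_, _, _⟩, ⟨h, rfl, rfl⟩, rfl⟩
    exact h

/-! ### Attainment and joint convexity -/

/-- The term of one outcome in the classical fidelity. -/
noncomputable def fidelityTerm (u v : ℝ) : ℝ := √u * √v

/-- The term of one outcome in the classical statistical distance. -/
noncomputable def deltaTerm (u v : ℝ) : ℝ := 1 / 2 * |u - v|

theorem fidelityTerm_mul (c u v : ℝ) (hc : 0 ≤ c) :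
    fidelityTerm (c * u) (c * v) = c * fidelityTerm u v := by
  simp only [fidelityTerm, Real.sqrt_mul hc]
  linear_combination √u * √v * Real.mul_self_sqrt hc

theorem deltaTerm_mul (c u v : ℝ) (hc : 0 ≤ c) :
    deltaTerm (c * u) (c * v) = c * deltaTerm u v := by
  simp only [deltaTerm, ← mul_sub, abs_mul, abs_of_nonneg hc]
  ring

theorem fidelityValues_eq (ρ σ : Matrix (Fin d) (Fin d) ℂ) :
    fidelityValues ρ σ = testValues fidelityTerm ρ σ := rfl

theorem deltaValues_eq (ρ σ : Matrix (Fin d) (Fin d) ℂ) :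
    deltaValues ρ σ = testValues deltaTerm ρ σ := by
  simp only [deltaValues, testValues, classicalDelta, deltaTerm, Finset.mul_sum]

theorem isGreatest_FMin {ρ σ : Matrix (Fin d) (Fin d) ℂ} (hρ : IsState ρ) (hσ : IsState σ) :
    IsGreatest (fidelityValues ρ σ) (FMin ρ σ) := by
  rw [FMin, fidelityValues_eq]
  refine (isCompact_testValues ?_ fidelityTerm_mul hρ hσ).isGreatest_sSup
    (testValues_nonempty _ hρ hσ)
  unfold fidelityTerm Function.uncurry
  fun_prop

theorem isLeast_DeltaMax {ρ σ : Matrix (Fin d) (Fin d) ℂ} (hρ : IsState ρ) (hσ : IsState σ) :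
    IsLeast (deltaValues ρ σ) (DeltaMax ρ σ) := by
  rw [DeltaMax, deltaValues_eq]
  refine (isCompact_testValues ?_ deltaTerm_mul hρ hσ).isLeast_sInf
    (testValues_nonempty _ hρ hσ)
  unfold deltaTerm Function.uncurry
  fun_prop

theorem IsState.convexCombination {ρ₀ ρ₁ : Matrix (Fin d) (Fin d) ℂ} (h₀ : IsState ρ₀)
    (h₁ : IsState ρ₁) {t : ℝ} (ht₀ : 0 ≤ t) (ht₁ : t ≤ 1) :
    IsState (t • ρ₀ + (1 - t) • ρ₁) := by
  refine ⟨(h₀.1.smul ht₀).add (h₁.1.smul (sub_nonneg.2 ht₁)), ?_⟩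
  simp [Matrix.trace_add, Matrix.trace_smul, h₀.2, h₁.2]

theorem DeltaMax_convex {ρ₀ ρ₁ σ₀ σ₁ : Matrix (Fin d) (Fin d) ℂ} (hρ₀ : IsState ρ₀)
    (hρ₁ : IsState ρ₁) (hσ₀ : IsState σ₀) (hσ₁ : IsState σ₁) {t : ℝ} (ht₀ : 0 ≤ t) (ht₁ : t ≤ 1) :
    DeltaMax (t • ρ₀ + (1 - t) • ρ₁) (t • σ₀ + (1 - t) • σ₁) ≤
      t * DeltaMax ρ₀ σ₀ + (1 - t) * DeltaMax ρ₁ σ₁ := by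
  have hρ := hρ₀.convexCombination hρ₁ ht₀ ht₁
  have hσ := hσ₀.convexCombination hσ₁ ht₀ ht₁
  apply (isLeast_DeltaMax hρ hσ).2
  have h₀ := (isLeast_DeltaMax hρ₀ hσ₀).1
  have h₁ := (isLeast_DeltaMax hρ₁ hσ₁).1
  rw [deltaValues_eq, mem_testValues_iff deltaTerm_mul] at h₀ h₁ ⊢
  any_goals assumption
  exact (convex_convexHull ℝ _) h₀ h₁ ht₀ (sub_nonneg.2 ht₁) (by ring)

/-! ### Functional calculus and supports -/

theorem continuousOn_spectrum (f : ℝ → ℝ) (A : Matrix (Fin d) (Fin d) ℂ) :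
    ContinuousOn f (spectrum ℝ A) :=
  Matrix.finite_real_spectrum.continuousOn f

theorem cfc_mul_cfc (f g : ℝ → ℝ) (A : Matrix (Fin d) (Fin d) ℂ) :
    cfc f A * cfc g A = cfc (fun t => f t * g t) A :=
  (cfc_mul f g A (continuousOn_spectrum f A) (continuousOn_spectrum g A)).symm

theorem conjTranspose_cfc (f : ℝ → ℝ) (A : Matrix (Fin d) (Fin d) ℂ) :
    (cfc f A)ᴴ = cfc f A :=
  (cfc_predicate f A : IsSelfAdjoint (cfc f A))

theorem cfc_eq_sum_spectral {T : Matrix (Fin d) (Fin d) ℂ} (hT : T.IsHermitian) (f : ℝ → ℝ) :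
    cfc f T = ∑ x, f (hT.eigenvalues x) •
      ((hT.eigenvectorUnitary : Matrix (Fin d) (Fin d) ℂ) * Matrix.single x x 1 *
        (hT.eigenvectorUnitary : Matrix (Fin d) (Fin d) ℂ)ᴴ) := by
  have h : Matrix.diagonal (RCLike.ofReal ∘ f ∘ hT.eigenvalues) =
      ∑ x, f (hT.eigenvalues x) • Matrix.single x x (1 : ℂ) :=
    map_diagState LinearMap.id fun x => f (hT.eigenvalues x)
  rw [hT.cfc_eq, Matrix.IsHermitian.cfc, Unitary.conjStarAlgAut_apply, h, Matrix.mul_sum,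
    Matrix.sum_mul]
  refine Finset.sum_congr rfl fun x _ => ?_
  rw [Matrix.mul_smul, Matrix.smul_mul, Matrix.star_eq_conjTranspose]

theorem nonneg_of_mem_spectrum {ρ : Matrix (Fin d) (Fin d) ℂ} (hρ : ρ.PosSemidef) {t : ℝ}
    (ht : t ∈ spectrum ℝ ρ) : 0 ≤ t := by
  rw [hρ.1.spectrum_real_eq_range_eigenvalues] at ht
  obtain ⟨i, rfl⟩ := ht
  exact hρ.eigenvalues_nonneg i

theorem cfc_sqrt_mul_cfc_sqrt {ρ : Matrix (Fin d) (Fin d) ℂ} (hρ : ρ.PosSemidef) :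
    cfc Real.sqrt ρ * cfc Real.sqrt ρ = ρ := by
  have hid : cfc (fun t : ℝ => t) ρ = ρ := cfc_id' ℝ ρ hρ.1
  conv_rhs => rw [← hid]
  rw [cfc_mul_cfc]
  exact cfc_congr fun t ht => Real.mul_self_sqrt (nonneg_of_mem_spectrum hρ ht)

theorem genInv_eq {σ : Matrix (Fin d) (Fin d) ℂ} (hσ : σ.PosSemidef) :
    genInv σ = cfc (fun t => (√t)⁻¹) σ * cfc (fun t => (√t)⁻¹) σ := by
  rw [cfc_mul_cfc, genInv]
  refine cfc_congr fun t ht => ?_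
  rw [← mul_inv, Real.mul_self_sqrt (nonneg_of_mem_spectrum hσ ht)]

/-- If the kernel of `σ` is contained in that of `ρ`, then `√ρ` is unchanged by multiplication with
the support projection of `σ`. -/
theorem sqrt_mul_support {ρ σ : Matrix (Fin d) (Fin d) ℂ} (hρ : ρ.PosSemidef) (hσ : σ.PosSemidef)
    (hsupp : ∀ v : Fin d → ℂ, σ *ᵥ v = 0 → ρ *ᵥ v = 0) :
    cfc Real.sqrt ρ * cfc (fun t => (√t)⁻¹) σ * cfc Real.sqrt σ = cfc Real.sqrt ρ := by
  set Q := 1 - cfc (fun t => (√t)⁻¹) σ * cfc Real.sqrt σ with hQ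
  have hσQ : σ * Q = 0 := by
    have hid : cfc (fun t : ℝ => t) σ = σ := cfc_id' ℝ σ hσ.1
    have : σ * (cfc (fun t => (√t)⁻¹) σ * cfc Real.sqrt σ) = σ := by
      nth_rewrite 1 [← hid]
      conv_rhs => rw [← hid]
      rw [cfc_mul_cfc, cfc_mul_cfc]
      refine cfc_congr fun t ht => ?_
      rcases (nonneg_of_mem_spectrum hσ ht).eq_or_lt with rfl | h
      · simp
      · simp [(Real.sqrt_pos.2 h).ne']
    rw [hQ, mul_sub, mul_one, this, sub_self]
  have hρQ : ρ * Q = 0 := by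
    ext i j
    have h1 : σ *ᵥ (Q.col j) = 0 := by
      ext k
      exact congrFun (congrFun hσQ k) j
    exact congrFun (hsupp _ h1) i
  -- With B = √ρ, (BQ)ᴴ(BQ) = Qᴴ ρ Q = 0 forces BQ = 0.
  have hsQ : cfc Real.sqrt ρ * Q = 0 := by
    rw [← Matrix.trace_conjTranspose_mul_self_eq_zero_iff, Matrix.conjTranspose_mul,
      conjTranspose_cfc, Matrix.mul_assoc, ← Matrix.mul_assoc (cfc Real.sqrt ρ),
      cfc_sqrt_mul_cfc_sqrt hρ, hρQ, Matrix.mul_zero, Matrix.trace_zero]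
  rw [hQ, mul_sub, mul_one, sub_eq_zero, ← mul_assoc] at hsQ
  exact hsQ.symm

/-! ### The reverse test built from √ρ σ⁻¹ √ρ -/

/-- If the support of `ρ` is contained in that of `σ`, some reverse test has fidelity at least
`1 - D^R(ρ‖σ) / 2`. -/
theorem exists_fidelity_of_support {ρ σ : Matrix (Fin d) (Fin d) ℂ} (hρ : IsState ρ)
    (hσ : IsState σ) (hsupp : ∀ v : Fin d → ℂ, σ *ᵥ v = 0 → ρ *ᵥ v = 0) :
    ∃ t ∈ fidelityValues ρ σ, 2 * (1 - t) ≤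
      (ρ * cfc Real.log (cfc Real.sqrt ρ * genInv σ * cfc Real.sqrt ρ)).trace.re := by
  set B := cfc Real.sqrt ρ with hB
  set R := cfc (fun t => (√t)⁻¹) σ with hR
  set S := cfc Real.sqrt σ with hS
  set A := B * R with hA
  have hBB : B * B = ρ := cfc_sqrt_mul_cfc_sqrt hρ.1
  have hSS : S * S = σ := cfc_sqrt_mul_cfc_sqrt hσ.1
  have hBH : Bᴴ = B := conjTranspose_cfc _ _
  have hSH : Sᴴ = S := conjTranspose_cfc _ _
  have hRH : Rᴴ = R := conjTranspose_cfc _ _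
  have hAS : A * S = B := sqrt_mul_support hρ.1 hσ.1 hsupp
  have hSA : S * Aᴴ = B := by
    have := congrArg Matrix.conjTranspose hAS
    rwa [Matrix.conjTranspose_mul, hSH, hBH] at this
  set T := B * genInv σ * B with hT
  have hTA : T = A * Aᴴ := by
    rw [hT, genInv_eq hσ.1, hA, Matrix.conjTranspose_mul, hRH, hBH]
    simp only [mul_assoc, hR]
  have hTpos : T.PosSemidef := hTA ▸ Matrix.posSemidef_self_mul_conjTranspose A
  have hTid : cfc (fun t : ℝ => t) T = T := cfc_id' ℝ T hTpos.1
  -- `Aᴴ * T⁺ * A` is a projection, so `B * T⁺ * B ≤ σ`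
  set G := cfc (fun t : ℝ => t⁻¹) T with hG
  have hGH : Gᴴ = G := conjTranspose_cfc _ _
  have hGTG : G * T * G = G := by
    nth_rewrite 1 [← hTid]
    rw [hG, cfc_mul_cfc, cfc_mul_cfc]
    exact cfc_congr fun t _ => by simpa only [inv_inv] using mul_inv_mul_cancel t⁻¹
  have hrem : (σ - B * G * B).PosSemidef := by
    have hPP : (1 - Aᴴ * G * A) * (1 - Aᴴ * G * A) = 1 - Aᴴ * G * A := by
      have : (Aᴴ * G * A) * (Aᴴ * G * A) = Aᴴ * G * A := by
        calc _ = Aᴴ * (G * (A * Aᴴ) * G) * A := by simp only [mul_assoc]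
          _ = _ := by rw [← hTA, hGTG]
      rw [mul_sub, sub_mul, sub_mul, this]; simp
    have hPH : (1 - Aᴴ * G * A)ᴴ = 1 - Aᴴ * G * A := by
      simp [Matrix.conjTranspose_mul, hGH, mul_assoc]
    have hpos : (1 - Aᴴ * G * A).PosSemidef := by
      have := Matrix.posSemidef_conjTranspose_mul_self (1 - Aᴴ * G * A)
      rwa [hPH, hPP] at this
    have := hpos.conjTranspose_mul_mul_same S
    convert this using 1
    calc σ - B * G * B = S * S - S * Aᴴ * G * (A * S) := by rw [hSS, hSA, hAS]
      _ = Sᴴ * (1 - Aᴴ * G * A) * S := by rw [hSH]; noncomm_ring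
  -- the spectral decomposition of `T` induces the reverse test
  let r := hTpos.1.eigenvalues
  have hr : ∀ x, 0 ≤ r x := hTpos.eigenvalues_nonneg
  let U : Matrix (Fin d) (Fin d) ℂ := hTpos.1.eigenvectorUnitary
  let W : Fin d → Matrix (Fin d) (Fin d) ℂ := fun x => B * (U * Matrix.single x x 1 * Uᴴ) * B
  have hW : ∀ x, (W x).PosSemidef := fun x => by
    have := ((posSemidef_single x).mul_mul_conjTranspose_same U).mul_mul_conjTranspose_same B
    rwa [hBH] at this
  have hsum : ∀ f : ℝ → ℝ, ∑ x, f (r x) • W x = B * cfc f T * B := by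
    intro f
    rw [cfc_eq_sum_spectral hTpos.1, Matrix.mul_sum, Matrix.sum_mul]
    exact Finset.sum_congr rfl fun x _ => by simp only [W, Matrix.mul_smul, Matrix.smul_mul]; rfl
  have hsumtr : ∀ f : ℝ → ℝ, ∑ x, f (r x) * (W x).trace.re = (ρ * cfc f T).trace.re := by
    intro f
    have h := congrArg (fun M => (Matrix.trace M).re) (hsum f)
    simp only [Matrix.trace_sum, Complex.re_sum] at h
    rw [Matrix.trace_mul_comm, ← mul_assoc, hBB] at h
    simpa using h
  have hWtr : ∀ x, 0 ≤ (W x).trace.re := fun x =>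
    (Complex.nonneg_iff.1 (hW x).trace_nonneg).1
  have hW1 : ∑ x, (W x).trace.re = 1 := by
    have h := hsumtr fun _ => 1
    rw [cfc_const_one ℝ T hTpos.1.isSelfAdjoint, mul_one, hρ.trace_re] at h
    simpa using h
  have hWρ : ∑ x, W x = ρ := by
    have h := hsum fun _ => 1
    rw [cfc_const_one ℝ T hTpos.1.isSelfAdjoint, mul_one, hBB] at h
    simpa using h
  -- `N` projects onto the kernel of T = A Aᴴ, so it annihilates A and hence B = A S. Outcomes with
  -- `r x = 0` therefore carry no weight, and the default 0⁻¹ = 0 costs nothing.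
  have hzero : ∀ x, r x = 0 → (W x).trace.re = 0 := by
    set N := cfc (fun t : ℝ => if t = 0 then 1 else 0) T with hN
    have hNH : Nᴴ = N := conjTranspose_cfc _ _
    have hNT : N * T = 0 := by
      nth_rewrite 1 [← hTid]
      rw [hN, cfc_mul_cfc, ← cfc_const_zero ℝ T]
      exact cfc_congr fun t _ => by simp
    have hNA : N * A = 0 := by
      rw [← Matrix.trace_mul_conjTranspose_self_eq_zero_iff, Matrix.conjTranspose_mul, hNH,
        mul_assoc, ← mul_assoc A, ← hTA, ← mul_assoc, hNT, zero_mul, Matrix.trace_zero]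
    have hNB : N * B = 0 := by rw [← hAS, ← mul_assoc, hNA, zero_mul]
    have h := hsumtr fun t => if t = 0 then 1 else 0
    rw [← hBB, ← hN, Matrix.trace_mul_comm, ← mul_assoc, hNB, zero_mul, Matrix.trace_zero,
      Complex.zero_re, Finset.sum_eq_zero_iff_of_nonneg
        (fun x _ => mul_nonneg (by split_ifs <;> simp) (hWtr x))] at h
    intro x hx
    simpa [hx] using h x (Finset.mem_univ x)
  -- The outcome `none` carries the remainder of σ and has p = 0, so it adds nothing to the
  -- fidelity.
  obtain ⟨m, Φ, p, q, htest, hval⟩ := exists_isReverseTest hρ hσ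
    (fun i : Option (Fin d) => i.elim (σ - B * G * B) W)
    (by rintro (_ | x); exacts [hrem, hW x])
    (fun i => i.elim 0 fun _ => 1) (fun i => i.elim 1 fun x => (r x)⁻¹)
    (by rintro (_ | x) <;> simp) (by rintro (_ | x) <;> simp [hr])
    (by simpa using hWρ)
    (by
      have := hsum fun t => t⁻¹
      simp only [Fintype.sum_option, Option.elim, this, one_smul]
      exact sub_add_cancel _ _)
  refine ⟨_, ⟨m, Φ, p, q, htest, rfl⟩, ?_⟩
  have hF : classicalFidelity p q = ∑ x, (W x).trace.re * √(r x)⁻¹ := by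
    have := hval fidelityTerm fidelityTerm_mul
    simpa [fidelityTerm, classicalFidelity] using this
  rw [hF, ← hsumtr Real.log, ← hW1, ← Finset.sum_sub_distrib, Finset.mul_sum]
  refine Finset.sum_le_sum fun x _ => ?_
  rcases (hr x).eq_or_lt with h0 | hpos
  · simp [hzero x h0.symm]
  · have hlog : Real.log (√(r x)⁻¹) ≤ √(r x)⁻¹ - 1 :=
      Real.log_le_sub_one_of_pos (Real.sqrt_pos.2 (inv_pos.2 hpos))
    rw [Real.log_sqrt (inv_pos.2 hpos).le, Real.log_inv] at hlog
    nlinarith [hWtr x]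

/-! ### Classical inequalities and their quantum consequences -/

/-- Termwise: (u + v)/2 - |u - v|/2 = min(u, v) ≤ √u √v. -/
theorem one_sub_classicalFidelity_le {m : ℕ} {p q : Fin m → ℝ} (hp : p ∈ stdSimplex ℝ (Fin m))
    (hq : q ∈ stdSimplex ℝ (Fin m)) : 1 - classicalFidelity p q ≤ classicalDelta p q := by
  have hx : ∀ x, (p x + q x) / 2 - √(p x) * √(q x) ≤ 1 / 2 * |p x - q x| := by
    intro x
    have h : min (p x) (q x) ≤ √(p x) * √(q x) := by
      rw [← Real.sqrt_mul (hp.1 x)]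
      refine Real.le_sqrt_of_sq_le ?_
      rw [sq]
      exact mul_le_mul (min_le_left _ _) (min_le_right _ _) (le_min (hp.1 x) (hq.1 x)) (hp.1 x)
    rw [min_def] at h
    split_ifs at h with hle
    · rw [abs_of_nonpos (by linarith)]; linarith
    · rw [abs_of_nonneg (by linarith)]; linarith
  have hsum := Finset.sum_le_sum fun x (_ : x ∈ Finset.univ) => hx x
  rw [Finset.sum_sub_distrib, ← Finset.sum_div, Finset.sum_add_distrib, hp.2, hq.2,
    ← Finset.mul_sum] at hsum
  unfold classicalFidelity classicalDelta
  linarith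

/-- Factor |p - q| = |√p - √q| |√p + √q| and apply Cauchy–Schwarz; the two sums of squares are 2 -
2F and 2 + 2F. -/
theorem classicalDelta_sq_le {m : ℕ} {p q : Fin m → ℝ} (hp : p ∈ stdSimplex ℝ (Fin m))
    (hq : q ∈ stdSimplex ℝ (Fin m)) :
    classicalDelta p q ^ 2 ≤ 1 - classicalFidelity p q ^ 2 := by
  have hfac : ∀ x, |p x - q x| = |√(p x) - √(q x)| * |√(p x) + √(q x)| := by
    intro x
    rw [← abs_mul]
    congr 1
    linear_combination Real.sq_sqrt (hq.1 x) - Real.sq_sqrt (hp.1 x)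
  have hsub : ∑ x, |√(p x) - √(q x)| ^ 2 = 2 - 2 * classicalFidelity p q := by
    have : ∀ x, |√(p x) - √(q x)| ^ 2 = p x + q x - 2 * (√(p x) * √(q x)) := fun x => by
      rw [sq_abs]
      linear_combination Real.sq_sqrt (hq.1 x) + Real.sq_sqrt (hp.1 x)
    simp only [this, Finset.sum_sub_distrib, Finset.sum_add_distrib, hp.2, hq.2, ← Finset.mul_sum,
      classicalFidelity]
    norm_num
  have hadd : ∑ x, |√(p x) + √(q x)| ^ 2 = 2 + 2 * classicalFidelity p q := by
    have : ∀ x, |√(p x) + √(q x)| ^ 2 = p x + q x + 2 * (√(p x) * √(q x)) := fun x => by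
      rw [sq_abs]
      linear_combination Real.sq_sqrt (hq.1 x) + Real.sq_sqrt (hp.1 x)
    simp only [this, Finset.sum_add_distrib, hp.2, hq.2, ← Finset.mul_sum, classicalFidelity]
    norm_num
  have hcs := Finset.sum_mul_sq_le_sq_mul_sq Finset.univ (fun x => |√(p x) - √(q x)|)
    fun x => |√(p x) + √(q x)|
  rw [hsub, hadd] at hcs
  simp only [← hfac] at hcs
  unfold classicalDelta
  linarith

theorem one_sub_FMin_le_DeltaMax {ρ σ : Matrix (Fin d) (Fin d) ℂ} (hρ : IsState ρ)
    (hσ : IsState σ) : 1 - FMin ρ σ ≤ DeltaMax ρ σ := by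
  obtain ⟨m, Φ, p, q, h, heq⟩ := (isLeast_DeltaMax hρ hσ).1
  have hF := (isGreatest_FMin hρ hσ).2 ⟨m, Φ, p, q, h, rfl⟩
  have := one_sub_classicalFidelity_le h.left_mem h.right_mem
  linarith

theorem DeltaMax_nonneg {ρ σ : Matrix (Fin d) (Fin d) ℂ} (hρ : IsState ρ) (hσ : IsState σ) :
    0 ≤ DeltaMax ρ σ := by
  obtain ⟨m, Φ, p, q, h, heq⟩ := (isLeast_DeltaMax hρ hσ).1
  rw [heq, classicalDelta]
  positivity

theorem DeltaMax_sq_le {ρ σ : Matrix (Fin d) (Fin d) ℂ} (hρ : IsState ρ) (hσ : IsState σ) :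
    DeltaMax ρ σ ^ 2 ≤ 1 - FMin ρ σ ^ 2 := by
  obtain ⟨m, Φ, p, q, h, heq⟩ := (isGreatest_FMin hρ hσ).1
  have hD := (isLeast_DeltaMax hρ hσ).2 ⟨m, Φ, p, q, h, rfl⟩
  rw [heq]
  exact (pow_le_pow_left₀ (DeltaMax_nonneg hρ hσ) hD 2).trans
    (classicalDelta_sq_le h.left_mem h.right_mem)

theorem half_DeltaMax_sq_le_DR {ρ σ : Matrix (Fin d) (Fin d) ℂ} (hρ : IsState ρ)
    (hσ : IsState σ) : (((1 / 2) * DeltaMax ρ σ ^ 2 : ℝ) : EReal) ≤ DR ρ σ := by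
  rw [DR]
  split_ifs with hsupp
  · obtain ⟨t, ht, hle⟩ := exists_fidelity_of_support hρ hσ hsupp
    have hF := (isGreatest_FMin hρ hσ).2 ht
    have hD := DeltaMax_sq_le hρ hσ
    rw [EReal.coe_le_coe_iff]
    -- Uses 1 - F² = 2(1 - F) - (1 - F)² ≤ 2(1 - F).
    nlinarith [sq_nonneg (1 - FMin ρ σ), sq_nonneg (DeltaMax ρ σ)]
  · exact le_top

end ReverseTest

theorem mainTheorem7 (d : ℕ) :
    -- the maximum and the minimum that define `F_min` and `Δ_max` are attained
    (∀ ρ σ : Matrix (Fin d) (Fin d) ℂ, ReverseTest.IsState ρ → ReverseTest.IsState σ →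
      IsGreatest (ReverseTest.fidelityValues ρ σ) (ReverseTest.FMin ρ σ) ∧
      IsLeast (ReverseTest.deltaValues ρ σ) (ReverseTest.DeltaMax ρ σ)) ∧
    -- joint convexity
    (∀ ρ₀ ρ₁ σ₀ σ₁ : Matrix (Fin d) (Fin d) ℂ,
      ReverseTest.IsState ρ₀ → ReverseTest.IsState ρ₁ →
      ReverseTest.IsState σ₀ → ReverseTest.IsState σ₁ →
      ∀ t : ℝ, 0 ≤ t → t ≤ 1 →
        ReverseTest.DeltaMax (t • ρ₀ + (1 - t) • ρ₁) (t • σ₀ + (1 - t) • σ₁) ≤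
          t * ReverseTest.DeltaMax ρ₀ σ₀ + (1 - t) * ReverseTest.DeltaMax ρ₁ σ₁) ∧
    -- comparison with `F_min`
    (∀ ρ σ : Matrix (Fin d) (Fin d) ℂ, ReverseTest.IsState ρ → ReverseTest.IsState σ →
      1 - ReverseTest.FMin ρ σ ≤ ReverseTest.DeltaMax ρ σ ∧
      ReverseTest.DeltaMax ρ σ ≤ √(1 - ReverseTest.FMin ρ σ ^ 2)) ∧
    -- Pinsker-type bound
    (∀ ρ σ : Matrix (Fin d) (Fin d) ℂ, ReverseTest.IsState ρ → ReverseTest.IsState σ →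
      (((1 / 2) * ReverseTest.DeltaMax ρ σ ^ 2 : ℝ) : EReal) ≤ ReverseTest.DR ρ σ) := by
  refine ⟨fun ρ σ hρ hσ => ⟨ReverseTest.isGreatest_FMin hρ hσ, ReverseTest.isLeast_DeltaMax hρ hσ⟩,
    fun _ _ _ _ h₁ h₂ h₃ h₄ _ ht₀ ht₁ => ReverseTest.DeltaMax_convex h₁ h₂ h₃ h₄ ht₀ ht₁,
    fun ρ σ hρ hσ => ⟨ReverseTest.one_sub_FMin_le_DeltaMax hρ hσ,
      Real.le_sqrt_of_sq_le (ReverseTest.DeltaMax_sq_le hρ hσ)⟩,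
    fun ρ σ hρ hσ => ReverseTest.half_DeltaMax_sq_le_DR hρ hσ⟩
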